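/- On $\mathbb{R}^6$ with coordinates $(x_1,x_2,y_1,y_2,z_1,z_2)$ consider $\xi=\ker\beta_1\cap\ker\beta_2$, where \[ \beta_1=dz_1-y_1\,dx_1-\frac{2y_2}{\pi(1+x_2^2)}\,dx_2-\Big(\frac{8}{3\pi^3}\arctan^3(x_2)+\frac{2}{\pi}\arctan(x_2)+2x_1\Big)dy_1, \] \[ \beta_2=dz_2-y_2\,dx_1-\frac{2y_1}{\pi(1+x_2^2)}\,dx_2 . \] For every point $q\in\mathbb{R}^6$ the germ of $\xi$ at $q$ has the following properties. (i) It is a fat corank-2 distribution germ. That is, near $q$, $\xi$ is the common kernel of two smooth pointwise linearly independent 1-forms, and at all points near $q$ the quadratic form $q_\xi(\psi,\psi)=(\psi\circ\mathcal L)\wedge(\psi\circ\mathcal L)\in\bigwedge^4\xi^*\cong\mathbb{R}$ on $Q^*$ is definite, where $Q=T\mathbb{R}^6/\xi$ and $\mathcal L:\bigwedge^2\xi\to Q$, $u\wedge v\mapsto[u,v]\bmod\xi$, is the curvature. (ii) $Z_1=\partial_{z_1}$ and $Z_2=\partial_{z_2}$ are Reeb directions for it. That is, near $q$ one can write $\xi=\ker\lambda_1\cap\ker\lambda_2$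 with smooth 1-forms $\lambda_1,\lambda_2$ such that $T\mathbb{R}^6=\xi\oplus\langle Z_1,Z_2\rangle$, $\lambda_i(Z_j)=\delta_{ij}$, $\iota_{Z_i}d\lambda_j|_\xi=0$ for $i,j\in\{1,2\}$, and $[Z_1,Z_2]=0$. (iii) No germ diffeomorphic to it supports a complex contact structure. That is, if the germ at $p$ of a distribution $D$ on a smooth 6-manifold $M$ is diffeomorphic to the germ of $\xi$ at $q$, then no neighbourhood of $p$ in $M$ carries a complex-manifold structure compatible with its smooth structure, together with a complex contact structure (a field of complex hyperplanes which is locally the kernel of a holomorphic 1-form $\theta$ with $\theta\wedge d\theta$ nowhere zero), whose underlying real distribution is $D$. Consequently Bhowmick's question has a negative answer: it is not true that every fat corank-2 distribution germ on $\mathbb{R}^6$ admitting Reeb directions is diffeomorphic to the germ of the real distribution underlying a complex contact structure. -/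

import Mathlib

open scoped Topology Manifold ContDiff

noncomputable section

/-- Real six-dimensional Euclidean space, with coordinates `(x₁, x₂, y₁, y₂, z₁, z₂)` numbered
`0, 1, 2, 3, 4, 5`. -/
abbrev R6 : Type := EuclideanSpace ℝ (Fin 6)

/-- Complex three-dimensional space. -/
abbrev C3 : Type := EuclideanSpace ℂ (Fin 3)

/-! ### Differential one-forms on a vector space -/

section Forms

variable {𝕜 : Type*} [NontriviallyNormedField 𝕜] {E : Type*} [NormedAddCommGroup E]
  [NormedSpace 𝕜 E]

/-- The value `dθ_x(u, v)` of the exterior derivative of the one-form `θ`. -/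
def extDerivOne (θ : E → E →L[𝕜] 𝕜) (x u v : E) : 𝕜 :=
  extDeriv (fun y => ContinuousAlternatingMap.ofSubsingleton 𝕜 E 𝕜 (0 : Fin 1) (θ y)) x ![u, v]

theorem extDerivOne_apply {θ : E → E →L[𝕜] 𝕜} {x : E} (h : DifferentiableAt 𝕜 θ x) (u v : E) :
    extDerivOne θ x u v = fderiv 𝕜 θ x u v - fderiv 𝕜 θ x v u := by
  let e : (E →L[𝕜] 𝕜) →L[𝕜] (E [⋀^Fin 1]→L[𝕜] 𝕜) :=
    (ContinuousAlternatingMap.ofSubsingletonLIE (𝕜 := 𝕜) (E := E) (F := 𝕜)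
      (0 : Fin 1)).toContinuousLinearEquiv.toContinuousLinearMap
  have h' : HasFDerivAt
      (fun y => ContinuousAlternatingMap.ofSubsingleton 𝕜 E 𝕜 (0 : Fin 1) (θ y))
      (e.comp (fderiv 𝕜 θ x)) x := e.hasFDerivAt.comp x h.hasFDerivAt
  rw [extDerivOne, extDeriv, h'.fderiv]
  have he : ∀ (f : E →L[𝕜] 𝕜) (w : Fin 1 → E), e f w = f (w 0) := fun _ _ => rfl
  simp [ContinuousAlternatingMap.alternatizeUncurryFin_apply, Fin.sum_univ_two, he,
    Fin.removeNth_apply, sub_eq_add_neg]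

/-- The value `(θ ∧ dθ)_x(u, v, w)`. -/
def wedgeExtDeriv (θ : E → E →L[𝕜] 𝕜) (x u v w : E) : 𝕜 :=
  θ x u * extDerivOne θ x v w - θ x v * extDerivOne θ x u w + θ x w * extDerivOne θ x u v

end Forms

/-! ### Corank-two distributions on `ℝ⁶`: curvature, fatness, Reeb directions -/

/-- On `U`, the field of subspaces `D` is the common kernel of the one-forms `lam 0`, `lam 1`. -/
def IsKernelOn (D : R6 → Submodule ℝ R6) (lam : Fin 2 → R6 → R6 →L[ℝ] ℝ) (U : Set R6) : Prop :=
  ∀ x ∈ U, D x = (lam 0 x).ker ⊓ (lam 1 x).ker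

/-- Near `q`, `D` is a smooth distribution of corank two, that is, the common kernel of two smooth,
pointwise linearly independent one-forms. -/
def IsCorankTwoGerm (D : R6 → Submodule ℝ R6) (q : R6) : Prop :=
  ∃ U : Set R6, IsOpen U ∧ q ∈ U ∧ ∃ lam : Fin 2 → R6 → R6 →L[ℝ] ℝ,
    (∀ i, ContDiffOn ℝ ∞ (lam i) U) ∧
    (∀ x ∈ U, LinearIndependent ℝ (fun i => lam i x)) ∧ IsKernelOn D lam U

/-- The vector field `u` restricts to a smooth section of `D` near `q`. -/
def IsLocalSection (D : R6 → Submodule ℝ R6) (q : R6) (u : R6 → R6) : Prop :=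
  ∃ U : Set R6, IsOpen U ∧ q ∈ U ∧ ContDiffOn ℝ ∞ u U ∧ ∀ x ∈ U, u x ∈ D x

/-- `L` is the curvature (Levi map) of `D` at `q`: `L(u(q), v(q)) = [u, v](q) mod D_q` for all local
sections `u`, `v` of `D`. For a smooth distribution of constant rank there is exactly one. -/
def IsCurvatureAt (D : R6 → Submodule ℝ R6) (q : R6)
    (L : D q →ₗ[ℝ] D q →ₗ[ℝ] (R6 ⧸ D q)) : Prop :=
  ∀ u v : R6 → R6, IsLocalSection D q u → IsLocalSection D q v → ∀ a b : D q,
    u q = a → v q = b → L a b = Submodule.Quotient.mk (VectorField.lieBracket ℝ u v q)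

/-- The wedge product `σ ∧ τ` of two alternating bilinear forms, evaluated at
`e 0, e 1, e 2, e 3`. -/
def wedgeTwoTwo {V : Type*} (σ τ : V → V → ℝ) (e : Fin 4 → V) : ℝ :=
  σ (e 0) (e 1) * τ (e 2) (e 3) - σ (e 0) (e 2) * τ (e 1) (e 3) + σ (e 0) (e 3) * τ (e 1) (e 2)
    + σ (e 1) (e 2) * τ (e 0) (e 3) - σ (e 1) (e 3) * τ (e 0) (e 2) + σ (e 2) (e 3) * τ (e 0) (e 1)

/-- The bilinear form `q_D(ψ, φ) = (ψ ∘ L) ∧ (φ ∘ L)` on the dual of the quotient, where the line of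
four-forms on the four-dimensional fibre is identified with `ℝ` by evaluation on a basis `e` (so `e`
plays the role of the chosen volume form). -/
def curvatureForm {W : Submodule ℝ R6} (L : W →ₗ[ℝ] W →ₗ[ℝ] (R6 ⧸ W)) (e : Module.Basis (Fin 4) ℝ W)
    (ψ φ : Module.Dual ℝ (R6 ⧸ W)) : ℝ :=
  wedgeTwoTwo (fun a b => ψ (L a b)) (fun a b => φ (L a b)) e

/-- The quadratic form `q_D` is definite at `q`, for every choice of volume form on `D_q`. -/
def IsEllipticAt (D : R6 → Submodule ℝ R6) (q : R6) : Prop :=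
  ∃ L : D q →ₗ[ℝ] D q →ₗ[ℝ] (R6 ⧸ D q), IsCurvatureAt D q L ∧
    ∀ e : Module.Basis (Fin 4) ℝ (D q),
      (∀ ψ : Module.Dual ℝ (R6 ⧸ D q), ψ ≠ 0 → 0 < curvatureForm L e ψ ψ) ∨
      (∀ ψ : Module.Dual ℝ (R6 ⧸ D q), ψ ≠ 0 → curvatureForm L e ψ ψ < 0)

/-- The germ of `D` at `q` is a fat (elliptic) corank-two distribution germ. -/
def IsFatGerm (D : R6 → Submodule ℝ R6) (q : R6) : Prop :=
  IsCorankTwoGerm D q ∧ ∀ᶠ x in 𝓝 q, IsEllipticAt D x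

/-- The vector fields `Z 0`, `Z 1` are Reeb directions of the corank-two distribution `D`
near `q`. -/
def HasReebDirections (D : R6 → Submodule ℝ R6) (Z : Fin 2 → R6 → R6) (q : R6) : Prop :=
  ∃ U : Set R6, IsOpen U ∧ q ∈ U ∧ (∀ i, ContDiffOn ℝ ∞ (Z i) U) ∧
    ∃ lam : Fin 2 → R6 → R6 →L[ℝ] ℝ, (∀ i, ContDiffOn ℝ ∞ (lam i) U) ∧ IsKernelOn D lam U ∧
      ∀ x ∈ U,
        IsCompl (D x) (Submodule.span ℝ (Set.range fun i => Z i x)) ∧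
        (∀ i j, lam i x (Z j x) = if i = j then 1 else 0) ∧
        (∀ i j, ∀ v ∈ D x, extDerivOne (lam j) x (Z i x) v = 0) ∧
        VectorField.lieBracket ℝ (Z 0) (Z 1) x = 0

/-! ### Complex contact structures and their underlying real distributions -/

/-- A field `H` of complex hyperplanes in the tangent spaces of the complex three-manifold `N` is a
complex contact structure: in the holomorphic chart around each point it is, near that point, the
kernel of a holomorphic one-form `θ` with `θ ∧ dθ` nowhere zero. -/
def IsComplexContact {N : Type*} [TopologicalSpace N] [ChartedSpace C3 N]
    (H : ∀ y : N, Submodule ℂ (TangentSpace 𝓘(ℂ, C3) y)) : Prop :=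
  ∀ y₀ : N, ∃ V : Set C3, IsOpen V ∧ chartAt C3 y₀ y₀ ∈ V ∧ V ⊆ (chartAt C3 y₀).target ∧
    ∃ θ : C3 → C3 →L[ℂ] ℂ, DifferentiableOn ℂ θ V ∧
      (∀ w ∈ V, ∃ a b c : C3, wedgeExtDeriv θ w a b c ≠ 0) ∧
      ∀ y ∈ (chartAt C3 y₀).source, chartAt C3 y₀ y ∈ V →
        ∀ v : TangentSpace 𝓘(ℂ, C3) y,
          v ∈ H y ↔ θ (chartAt C3 y₀ y) (mfderiv 𝓘(ℂ, C3) 𝓘(ℂ, C3) (chartAt C3 y₀) y v) = 0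

/-- The germ at `p` of the distribution `D` on the smooth six-manifold `M` supports a complex contact
structure: a smooth diffeomorphism `f` identifies a neighbourhood of `p` with an open subset of a
complex three-manifold `N` carrying a complex contact structure `H`, in such a way that `D` becomes
the real distribution underlying `H`. -/
def SupportsComplexContact.{u} {M : Type u} [TopologicalSpace M] [ChartedSpace R6 M]
    (D : ∀ x : M, Submodule ℝ (TangentSpace 𝓘(ℝ, R6) x)) (p : M) : Prop :=
  ∃ (N : Type u) (_ : TopologicalSpace N) (_ : ChartedSpace C3 N)
    (_ : IsManifold 𝓘(ℂ, C3) ω N) (H : ∀ y : N, Submodule ℂ (TangentSpace 𝓘(ℂ, C3) y))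
    (f : OpenPartialHomeomorph M N),
    IsComplexContact H ∧ p ∈ f.source ∧
    ContMDiffOn 𝓘(ℝ, R6) 𝓘(ℝ, C3) ∞ f f.source ∧
    ContMDiffOn 𝓘(ℝ, C3) 𝓘(ℝ, R6) ∞ f.symm f.target ∧
    ∀ x ∈ f.source, ∀ v : TangentSpace 𝓘(ℝ, R6) x,
      v ∈ D x ↔ (mfderiv 𝓘(ℝ, R6) 𝓘(ℝ, C3) f x v : C3) ∈ H (f x)

/-- The germ at `p` of the distribution `D` on `M` and the germ at `p'` of the distribution `D'`
on `M'` are diffeomorphic. -/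
def GermDiffeomorphic {M M' : Type*} [TopologicalSpace M] [ChartedSpace R6 M]
    [TopologicalSpace M'] [ChartedSpace R6 M']
    (D : ∀ x : M, Submodule ℝ (TangentSpace 𝓘(ℝ, R6) x)) (p : M)
    (D' : ∀ x : M', Submodule ℝ (TangentSpace 𝓘(ℝ, R6) x)) (p' : M') : Prop :=
  ∃ g : OpenPartialHomeomorph M M', p ∈ g.source ∧ g p = p' ∧
    ContMDiffOn 𝓘(ℝ, R6) 𝓘(ℝ, R6) ∞ g g.source ∧
    ContMDiffOn 𝓘(ℝ, R6) 𝓘(ℝ, R6) ∞ g.symm g.target ∧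
    ∀ x ∈ g.source, ∀ v : TangentSpace 𝓘(ℝ, R6) x,
      v ∈ D x ↔ mfderiv 𝓘(ℝ, R6) 𝓘(ℝ, R6) g x v ∈ D' (g x)

/-! ### The distribution -/

/-- The coordinate one-form `dcᵢ` on `ℝ⁶`, `c` running through `x₁, x₂, y₁, y₂, z₁, z₂`. -/
def dCoord (i : Fin 6) : R6 →L[ℝ] ℝ := EuclideanSpace.proj i

/-- The coordinate vector field `∂_{cᵢ}` on `ℝ⁶`. -/
def coordField (i : Fin 6) : R6 → R6 := fun _ => EuclideanSpace.single i 1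

/-- `β₁ = dz₁ - y₁ dx₁ - 2y₂/(π(1+x₂²)) dx₂
  - (8/(3π³) arctan³ x₂ + (2/π) arctan x₂ + 2x₁) dy₁`. -/
def betaOne (p : R6) : R6 →L[ℝ] ℝ :=
  dCoord 4 - p 2 • dCoord 0 - (2 * p 3 / (Real.pi * (1 + p 1 ^ 2))) • dCoord 1
    - (8 / (3 * Real.pi ^ 3) * Real.arctan (p 1) ^ 3 + 2 / Real.pi * Real.arctan (p 1) + 2 * p 0)
      • dCoord 2

/-- `β₂ = dz₂ - y₂ dx₁ - 2y₁/(π(1+x₂²)) dx₂`. -/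
def betaTwo (p : R6) : R6 →L[ℝ] ℝ :=
  dCoord 5 - p 3 • dCoord 0 - (2 * p 2 / (Real.pi * (1 + p 1 ^ 2))) • dCoord 1

/-- The distribution `ξ = ker β₁ ∩ ker β₂`. -/
def xi (p : R6) : Submodule ℝ R6 := (betaOne p).ker ⊓ (betaTwo p).ker

end

/-!
If `xi` is locally the kernel of `α = F^* θ` with `θ` a holomorphic one-form on `ℂ³`, then
`dα ∧ dα = 0`, because `dθ ∧ dθ` is an alternating complex four-form on a complex three-dimensional
space. Write `α = a β₁ + b β₂` with complex functions `a`, `b`, and put `t = (2 / π) arctan x₂`,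
`t' = ∂t / ∂x₂`. On `xi`, the equation `dα ∧ dα = 0` reads `a² + b² - (1 + t²) a b = 0`; for real
`a`, `b` this quadratic form is definite since `|t| < 1`, which is fatness. Evaluating `dα ∧ dα` on
`X₁`, `X₂`, `Y₁` and a Reeb direction shows that the complex vector field
`W = a X₂ + t' (b - (1 + t²) a) X₁` annihilates `a` and `b`, whereas `W t = a t'`. Differentiating
the quadric along `W` therefore gives `t t' a² b = 0`, which is impossible off `x₂ = 0` since
neither `a` nor `b` vanishes.
-/

noncomputable section

section Pfaffian

/-- The Pfaffian of an alternating `4 × 4` matrix; if the entries are `ω (wᵢ, wⱼ)` for a two-form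
`ω`, it is half of `(ω ∧ ω) (w₀, w₁, w₂, w₃)`. Only the entries above the diagonal are used. -/
def pfaffian {R : Type*} [CommRing R] (A : Matrix (Fin 4) (Fin 4) R) : R :=
  A 0 1 * A 2 3 - A 0 2 * A 1 3 + A 0 3 * A 1 2

section CommRing

variable {R : Type*} [CommRing R]

theorem eq_of_diag_eq_zero_of_skew {A : Matrix (Fin 4) (Fin 4) R} (hdiag : ∀ i, A i i = 0)
    (hskew : ∀ i j, A j i = -A i j) :
    A = !![0, A 0 1, A 0 2, A 0 3; -A 0 1, 0, A 1 2, A 1 3;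
      -A 0 2, -A 1 2, 0, A 2 3; -A 0 3, -A 1 3, -A 2 3, 0] := by
  ext i j
  fin_cases i <;> fin_cases j <;> first | rfl | exact hdiag _ | exact hskew _ _

theorem det_eq_pfaffian_sq {A : Matrix (Fin 4) (Fin 4) R} (hdiag : ∀ i, A i i = 0)
    (hskew : ∀ i j, A j i = -A i j) : A.det = pfaffian A ^ 2 := by
  rw [eq_of_diag_eq_zero_of_skew hdiag hskew, Matrix.det_succ_row_zero]
  simp only [Fin.sum_univ_four, Matrix.det_fin_three, Matrix.submatrix_apply, Matrix.of_apply,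
    Matrix.cons_val, Fin.succAbove, Fin.reduceLT, Fin.reduceCastSucc, Fin.reduceSucc, reduceIte,
    Fin.coe_ofNat_eq_mod, pfaffian]
  ring

theorem pfaffian_transpose_mul_mul {A : Matrix (Fin 4) (Fin 4) R} (hdiag : ∀ i, A i i = 0)
    (hskew : ∀ i j, A j i = -A i j) (P : Matrix (Fin 4) (Fin 4) R) :
    pfaffian (P.transpose * A * P) = P.det * pfaffian A := by
  rw [eq_of_diag_eq_zero_of_skew hdiag hskew, Matrix.det_succ_row_zero]
  simp only [Fin.sum_univ_four, Matrix.det_fin_three, Matrix.submatrix_apply, Matrix.of_apply,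
    Matrix.cons_val, Fin.succAbove, Fin.reduceLT, Fin.reduceCastSucc, Fin.reduceSucc, reduceIte,
    Fin.coe_ofNat_eq_mod, pfaffian, Matrix.mul_apply, Matrix.transpose_apply]
  ring

end CommRing

theorem pfaffian_eq_zero_of_finrank_lt_four {K V : Type*} [Field K] [AddCommGroup V] [Module K V]
    [FiniteDimensional K V] (hV : Module.finrank K V < 4) {B : LinearMap.BilinForm K V}
    (hB : B.IsAlt) (w : Fin 4 → V) : pfaffian (Matrix.of fun i j => B (w i) (w j)) = 0 := by
  have hdep : ¬ LinearIndependent K w := fun h => by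
    simpa using h.fintype_card_le_finrank.trans_lt hV
  obtain ⟨c, hc, i, hi⟩ := Fintype.not_linearIndependent_iff.1 hdep
  have hdet : (Matrix.of fun i j => B (w i) (w j)).det = 0 :=
    Matrix.exists_mulVec_eq_zero_iff.1 ⟨c, fun h => hi (congrFun h i), funext fun k => by
      simpa [Matrix.mulVec, dotProduct, mul_comm] using congrArg (B (w k)) hc⟩
  have hsq := det_eq_pfaffian_sq (A := Matrix.of fun i j => B (w i) (w j)) (fun i => hB (w i))
    (fun i j => (hB.neg_eq (w i) (w j)).symm)
  exact (pow_eq_zero_iff two_ne_zero).1 (hsq.symm.trans hdet)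

end Pfaffian

section ExteriorDerivative

variable {𝕜 E F : Type*} [NontriviallyNormedField 𝕜] [NormedAddCommGroup E] [NormedSpace 𝕜 E]
  [NormedAddCommGroup F] [NormedSpace 𝕜 F]

/-- The exterior derivative of a one-form `α` at `x`, as a bilinear map. Unlike `extDerivOne` it
allows values in a normed space, such as `ℂ` for forms on a real vector space. -/
def extDerivBilin (𝕜 : Type*) {E F : Type*} [NontriviallyNormedField 𝕜] [NormedAddCommGroup E]
    [NormedSpace 𝕜 E] [NormedAddCommGroup F] [NormedSpace 𝕜 F] (α : E → E →L[𝕜] F) (x : E) :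
    E →L[𝕜] E →L[𝕜] F :=
  fderiv 𝕜 α x - (fderiv 𝕜 α x).flip

variable {α β : E → E →L[𝕜] F} {x : E}

theorem extDerivBilin_apply (α : E → E →L[𝕜] F) (x u v : E) :
    extDerivBilin 𝕜 α x u v = fderiv 𝕜 α x u v - fderiv 𝕜 α x v u := rfl

theorem extDerivBilin_self (α : E → E →L[𝕜] F) (x u : E) : extDerivBilin 𝕜 α x u u = 0 :=
  sub_self _

theorem extDerivBilin_congr (h : α =ᶠ[𝓝 x] β) :
    extDerivBilin 𝕜 α x = extDerivBilin 𝕜 β x := by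
  rw [extDerivBilin, h.fderiv_eq, extDerivBilin]

theorem extDeriv_ofSubsingleton (α : E → E →L[𝕜] F) (x u v : E) :
    extDeriv (fun y => ContinuousAlternatingMap.ofSubsingleton 𝕜 E F (0 : Fin 1) (α y)) x ![u, v]
      = extDerivBilin 𝕜 α x u v := by
  let e := (ContinuousAlternatingMap.ofSubsingletonLIE (𝕜 := 𝕜) (E := E) (F := F)
    (0 : Fin 1)).toContinuousLinearEquiv
  have h : fderiv 𝕜 (fun y => ContinuousAlternatingMap.ofSubsingleton 𝕜 E F (0 : Fin 1) (α y)) x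
      = (e : (E →L[𝕜] F) →L[𝕜] E [⋀^Fin 1]→L[𝕜] F).comp (fderiv 𝕜 α x) := e.comp_fderiv
  simp [extDeriv, h, e, ContinuousAlternatingMap.alternatizeUncurryFin_apply, Fin.sum_univ_two,
    Fin.removeNth_apply, extDerivBilin_apply, sub_eq_add_neg]

theorem extDerivBilin_pullback {G : Type*} [NormedAddCommGroup G] [NormedSpace 𝕜 G]
    {θ : G → G →L[𝕜] F} {f : E → G} {n : WithTop ℕ∞} (hθ : DifferentiableAt 𝕜 θ (f x))
    (hf : ContDiffAt 𝕜 n f x) (hn : minSmoothness 𝕜 2 ≤ n) (u v : E) :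
    extDerivBilin 𝕜 (fun y => (θ (f y)).comp (fderiv 𝕜 f y)) x u v
      = extDerivBilin 𝕜 θ (f x) (fderiv 𝕜 f x u) (fderiv 𝕜 f x v) := by
  have hω := (ContinuousAlternatingMap.ofSubsingletonLIE (𝕜 := 𝕜) (E := G) (F := F)
    (0 : Fin 1)).toContinuousLinearEquiv.differentiableAt.comp (f x) hθ
  have h := congrArg (· ![u, v]) (extDeriv_pullback hω hf hn)
  rw [← extDeriv_ofSubsingleton, ← extDeriv_ofSubsingleton]
  refine h.trans ?_
  have hcomp : fderiv 𝕜 f x ∘ ![u, v] = ![fderiv 𝕜 f x u, fderiv 𝕜 f x v] :=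
    funext (Fin.forall_fin_two.2 ⟨rfl, rfl⟩)
  rw [ContinuousAlternatingMap.compContinuousLinearMap_apply, hcomp]
  rfl

theorem extDerivBilin_sum_smulRight {ι : Type*} [Fintype ι] {lam : ι → E → E →L[𝕜] 𝕜}
    {a : ι → E → F} (hlam : ∀ i, DifferentiableAt 𝕜 (lam i) x)
    (ha : ∀ i, DifferentiableAt 𝕜 (a i) x) (u v : E) :
    extDerivBilin 𝕜 (fun y => ∑ i, (lam i y).smulRight (a i y)) x u v
      = ∑ i, (extDerivBilin 𝕜 (lam i) x u v • a i x + lam i x v • fderiv 𝕜 (a i) x u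
          - lam i x u • fderiv 𝕜 (a i) x v) := by
  have h : HasFDerivAt (fun y => ∑ i, (lam i y).smulRight (a i y)) _ x :=
    HasFDerivAt.fun_sum fun i _ => (ContinuousLinearMap.smulRightL 𝕜 E F).hasFDerivAt_of_bilinear
      (hlam i).hasFDerivAt (ha i).hasFDerivAt
  rw [extDerivBilin_apply, h.fderiv]
  simp only [ContinuousLinearMap.precompR_apply, ContinuousLinearMap.compL_apply, sum_apply,
    add_apply, ContinuousLinearMap.comp_apply, ContinuousLinearMap.smulRightL_apply_apply,
    ContinuousLinearMap.precompL_apply, ContinuousLinearMap.smulRight_apply,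
    ← Finset.sum_sub_distrib, extDerivBilin_apply, sub_smul]
  refine Finset.sum_congr rfl fun i _ => ?_
  abel

theorem apply_lieBracket_of_eventually_eq_zero {u v : E → E} (hα : DifferentiableAt 𝕜 α x)
    (hu : DifferentiableAt 𝕜 u x) (hv : DifferentiableAt 𝕜 v x)
    (hαu : ∀ᶠ y in 𝓝 x, α y (u y) = 0) (hαv : ∀ᶠ y in 𝓝 x, α y (v y) = 0) :
    α x (VectorField.lieBracket 𝕜 u v x) = -extDerivBilin 𝕜 α x (u x) (v x) := by
  have leibniz {w : E → E} (hw : DifferentiableAt 𝕜 w x) (hαw : ∀ᶠ y in 𝓝 x, α y (w y) = 0)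
      (z : E) : α x (fderiv 𝕜 w x z) + fderiv 𝕜 α x z (w x) = 0 := by
    have h := (hα.hasFDerivAt.clm_apply hw.hasFDerivAt).unique
      ((hasFDerivAt_const (0 : F) x).congr_of_eventuallyEq hαw)
    simpa using DFunLike.congr_fun h z
  rw [VectorField.lieBracket, map_sub, extDerivBilin_apply, eq_neg_of_add_eq_zero_left
    (leibniz hu hαu (v x)), eq_neg_of_add_eq_zero_left (leibniz hv hαv (u x))]
  abel

end ExteriorDerivative

section RestrictScalars

variable (𝕜 : Type*) {𝕜' E F : Type*} [NontriviallyNormedField 𝕜] [NontriviallyNormedField 𝕜']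
  [NormedAlgebra 𝕜 𝕜'] [NormedAddCommGroup E] [NormedSpace 𝕜 E] [NormedSpace 𝕜' E]
  [IsScalarTower 𝕜 𝕜' E] [NormedAddCommGroup F] [NormedSpace 𝕜 F] [NormedSpace 𝕜' F]
  [IsScalarTower 𝕜 𝕜' F]

theorem hasFDerivAt_restrictScalars_oneForm {α : E → E →L[𝕜'] F} {x : E}
    (hα : DifferentiableAt 𝕜' α x) :
    HasFDerivAt (fun y => (α y).restrictScalars 𝕜)
      ((ContinuousLinearMap.restrictScalarsL 𝕜' E F 𝕜 𝕜).comp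
        ((fderiv 𝕜' α x).restrictScalars 𝕜)) x :=
  (ContinuousLinearMap.restrictScalarsL 𝕜' E F 𝕜 𝕜).hasFDerivAt.comp x
    (hα.hasFDerivAt.restrictScalars 𝕜)

theorem extDerivBilin_restrictScalars {α : E → E →L[𝕜'] F} {x : E}
    (hα : DifferentiableAt 𝕜' α x) (u v : E) :
    extDerivBilin 𝕜 (fun y => (α y).restrictScalars 𝕜) x u v = extDerivBilin 𝕜' α x u v := by
  rw [extDerivBilin_apply, (hasFDerivAt_restrictScalars_oneForm 𝕜 hα).fderiv]
  rfl

theorem hasMFDerivAt_restrictScalars {N : Type*} [TopologicalSpace N] [ChartedSpace E N]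
    {f : N → F} {y : N} {f' : E →L[𝕜'] F} (h : HasMFDerivAt 𝓘(𝕜', E) 𝓘(𝕜', F) f y f') :
    HasMFDerivAt 𝓘(𝕜, E) 𝓘(𝕜, F) f y (f'.restrictScalars 𝕜) :=
  ⟨h.1, h.2.restrictScalars 𝕜⟩

variable (𝕜') in
theorem isManifold_restrictScalars {N : Type*} [TopologicalSpace N] [ChartedSpace E N]
    {n : WithTop ℕ∞} [IsManifold 𝓘(𝕜', E) n N] : IsManifold 𝓘(𝕜, E) n N := by
  refine isManifold_of_contDiffOn 𝓘(𝕜, E) n N fun e e' he he' => ?_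
  have h := (contDiffGroupoid n 𝓘(𝕜', E)).compatible he he'
  rw [contDiffGroupoid, mem_groupoid_of_pregroupoid] at h
  exact h.1.restrict_scalars 𝕜

end RestrictScalars

section DualFamily

variable {R V M ι : Type*} [CommRing R] [AddCommGroup V] [Module R V] [AddCommGroup M]
  [Module R M] [DecidableEq ι] {φ : ι → Module.Dual R V} {z : ι → V}
  {W : Submodule R V}

theorem apply_eq_sum_of_eq_zero_on_ker [Fintype ι] (hφz : ∀ i j, φ i (z j) = if i = j then 1 else 0)
    (hW : ∀ v, v ∈ W ↔ ∀ i, φ i v = 0) {f : V →ₗ[R] M} (hf : ∀ v ∈ W, f v = 0) (v : V) :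
    f v = ∑ i, φ i v • f (z i) := by
  have hv : v - ∑ i, φ i v • z i ∈ W := (hW _).2 fun j => by simp [hφz]
  simpa [sub_eq_zero] using hf _ hv

theorem isCompl_span_range_of_dual [Finite ι] (hφz : ∀ i j, φ i (z j) = if i = j then 1 else 0)
    (hW : ∀ v, v ∈ W ↔ ∀ i, φ i v = 0) : IsCompl W (Submodule.span R (Set.range z)) := by
  have := Fintype.ofFinite ι
  constructor
  · refine Submodule.disjoint_def.2 fun v hv hvz => ?_
    obtain ⟨c, rfl⟩ := (Submodule.mem_span_range_iff_exists_fun R).1 hvz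
    have hc : ∀ i, c i = 0 := fun i => by simpa [hφz] using (hW _).1 hv i
    simp [hc]
  · refine codisjoint_iff.2 (eq_top_iff.2 fun v _ => ?_)
    rw [← sub_add_cancel v (∑ i, φ i v • z i)]
    exact Submodule.add_mem_sup ((hW _).2 fun j => by simp [hφz])
      (sum_mem fun i _ => Submodule.smul_mem _ _ (Submodule.subset_span ⟨i, rfl⟩))

end DualFamily

section Curvature

variable {D : R6 → Submodule ℝ R6} {q : R6}

theorem IsKernelOn.mem_iff {lam : Fin 2 → R6 → R6 →L[ℝ] ℝ} {U : Set R6} (h : IsKernelOn D lam U)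
    {x : R6} (hx : x ∈ U) (v : R6) : v ∈ D x ↔ ∀ i, lam i x v = 0 := by
  rw [h x hx, Fin.forall_fin_two]; rfl

/-- The candidate `(u, v) ↦ -∑ᵢ dλᵢ(u, v) [zᵢ]` for the curvature of the common kernel `W` of the
one-forms `λᵢ` at `q`, where `zᵢ` is dual to `λᵢ`. -/
def coframeCurvature (lam : Fin 2 → R6 → R6 →L[ℝ] ℝ) (z : Fin 2 → R6) (q : R6)
    (W : Submodule ℝ R6) : W →ₗ[ℝ] W →ₗ[ℝ] R6 ⧸ W :=
  -∑ i, ((extDerivBilin ℝ (lam i) q).toLinearMap₁₂.domRestrict₁₂ W W).compr₂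
    (LinearMap.toSpanSingleton ℝ (R6 ⧸ W) (W.mkQ (z i)))

theorem coframeCurvature_apply (lam : Fin 2 → R6 → R6 →L[ℝ] ℝ) (z : Fin 2 → R6) (q : R6)
    (W : Submodule ℝ R6) (a b : W) :
    coframeCurvature lam z q W a b = -∑ i, extDerivBilin ℝ (lam i) q a b • W.mkQ (z i) := by
  simp [coframeCurvature, LinearMap.domRestrict₁₂_apply]

theorem isCurvatureAt_coframeCurvature {lam : Fin 2 → R6 → R6 →L[ℝ] ℝ} {z : Fin 2 → R6}
    {U : Set R6} (hU : U ∈ 𝓝 q) (hD : IsKernelOn D lam U)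
    (hlam : ∀ i, DifferentiableAt ℝ (lam i) q)
    (hz : ∀ i j, lam i q (z j) = if i = j then 1 else 0) :
    IsCurvatureAt D q (coframeCurvature lam z q (D q)) := by
  have section_spec {w : R6 → R6} (hw : IsLocalSection D q w) :
      DifferentiableAt ℝ w q ∧ ∀ i, ∀ᶠ y in 𝓝 q, lam i y (w y) = 0 := by
    obtain ⟨V, hV, hqV, hwV, hwD⟩ := hw
    refine ⟨(hwV.contDiffAt (hV.mem_nhds hqV)).differentiableAt (by simp), fun i => ?_⟩
    filter_upwards [hU, hV.mem_nhds hqV] with y hyU hyV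
    exact (hD.mem_iff hyU _).1 (hwD y hyV) i
  intro u v hu hv a b ha hb
  have bracket_mod := apply_eq_sum_of_eq_zero_on_ker (φ := fun i => (lam i q : R6 →ₗ[ℝ] ℝ))
    (f := (D q).mkQ) hz (hD.mem_iff (mem_of_mem_nhds hU)) (fun v => by simp)
    (VectorField.lieBracket ℝ u v q)
  have bracket_coeff (i : Fin 2) :
      lam i q (VectorField.lieBracket ℝ u v q) = -extDerivBilin ℝ (lam i) q a b := by
    rw [apply_lieBracket_of_eventually_eq_zero (hlam i) (section_spec hu).1 (section_spec hv).1
      ((section_spec hu).2 i) ((section_spec hv).2 i), ha, hb]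
  rw [coframeCurvature_apply, ← Submodule.mkQ_apply, bracket_mod]
  simp [bracket_coeff]

variable {W : Submodule ℝ R6} {L : W →ₗ[ℝ] W →ₗ[ℝ] (R6 ⧸ W)}

theorem curvatureForm_self (L : W →ₗ[ℝ] W →ₗ[ℝ] (R6 ⧸ W)) (e : Module.Basis (Fin 4) ℝ W)
    (ψ : Module.Dual ℝ (R6 ⧸ W)) :
    curvatureForm L e ψ ψ = 2 * pfaffian (Matrix.of fun i j => ψ (L (e i) (e j))) := by
  simp only [curvatureForm, wedgeTwoTwo, pfaffian, Matrix.of_apply]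
  ring

theorem curvatureForm_eq_det_mul (hL : L.IsAlt) (b e : Module.Basis (Fin 4) ℝ W)
    (ψ : Module.Dual ℝ (R6 ⧸ W)) :
    curvatureForm L e ψ ψ = (b.toMatrix e).det * curvatureForm L b ψ ψ := by
  let σ : LinearMap.BilinForm ℝ W := L.compr₂ ψ
  have hσ (c : Module.Basis (Fin 4) ℝ W) :
      Matrix.of (fun i j => ψ (L (c i) (c j))) = LinearMap.BilinForm.toMatrix c σ := by
    ext i j
    simp [σ, LinearMap.BilinForm.toMatrix_apply]
  have hσalt : σ.IsAlt := fun a => by simp [σ, hL a]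
  rw [curvatureForm_self, curvatureForm_self, hσ, hσ,
    ← LinearMap.BilinForm.toMatrix_mul_basis_toMatrix b e, pfaffian_transpose_mul_mul]
  · ring
  · exact fun i => by simpa [LinearMap.BilinForm.toMatrix_apply] using hσalt (b i)
  · exact fun i j => by
      simpa [LinearMap.BilinForm.toMatrix_apply] using (hσalt.neg_eq (b i) (b j)).symm

theorem isEllipticAt_of_curvatureForm_pos {L : D q →ₗ[ℝ] D q →ₗ[ℝ] (R6 ⧸ D q)}
    (hL : IsCurvatureAt D q L) (hLalt : L.IsAlt) (b : Module.Basis (Fin 4) ℝ (D q))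
    (hb : ∀ ψ : Module.Dual ℝ (R6 ⧸ D q), ψ ≠ 0 → 0 < curvatureForm L b ψ ψ) :
    IsEllipticAt D q := by
  refine ⟨L, hL, fun e => ?_⟩
  have hdet : (b.toMatrix e).det ≠ 0 := by
    simpa [Module.Basis.det_apply] using (b.isUnit_det e).ne_zero
  rcases hdet.lt_or_gt with hneg | hpos
  · right
    intro ψ hψ
    rw [curvatureForm_eq_det_mul hLalt b e]
    exact mul_neg_of_neg_of_pos hneg (hb ψ hψ)
  · left
    intro ψ hψ
    rw [curvatureForm_eq_det_mul hLalt b e]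
    exact mul_pos hpos (hb ψ hψ)

end Curvature

section Distribution

variable {p : R6}

/-- The coordinate `t = (2 / π) arctan x₂`, with values in `(-1, 1)`, in which the coefficients of
`betaOne` are polynomial. -/
def tCoord (p : R6) : ℝ := 2 / Real.pi * Real.arctan (p 1)

/-- The factor `∂t / ∂x₂`, where `t` is `tCoord`. -/
def tDeriv (p : R6) : ℝ := 2 / (Real.pi * (1 + p 1 ^ 2))

theorem tDeriv_pos (p : R6) : 0 < tDeriv p := by
  unfold tDeriv
  positivity

theorem tCoord_sq_lt_one (p : R6) : tCoord p ^ 2 < 1 := by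
  have hlower := Real.neg_pi_div_two_lt_arctan (p 1)
  have hupper := Real.arctan_lt_pi_div_two (p 1)
  have htCoord : tCoord p = Real.arctan (p 1) / (Real.pi / 2) := by
    unfold tCoord
    field_simp
  rw [sq_lt_one_iff_abs_lt_one, htCoord, abs_lt, lt_div_iff₀ (by positivity),
    div_lt_iff₀ (by positivity)]
  constructor <;> linarith

theorem tCoord_ne_zero (hp : p 1 ≠ 0) : tCoord p ≠ 0 := by
  simp [tCoord, Real.pi_ne_zero, hp, Real.arctan_eq_zero_iff]

theorem dCoord_apply (i : Fin 6) (v : R6) : dCoord i v = v i := rfl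

theorem contDiff_coord (i : Fin 6) : ContDiff ℝ ∞ (fun y : R6 => y i) := (dCoord i).contDiff

theorem hasFDerivAt_coord (i : Fin 6) (p : R6) : HasFDerivAt (fun y : R6 => y i) (dCoord i) p :=
  (dCoord i).hasFDerivAt

theorem contDiff_tCoord : ContDiff ℝ ∞ tCoord :=
  contDiff_const.mul ((contDiff_coord 1).arctan)

theorem contDiff_tDeriv : ContDiff ℝ ∞ tDeriv :=
  contDiff_const.div (contDiff_const.mul (contDiff_const.add ((contDiff_coord 1).pow 2)))
    fun _ => by positivity

theorem hasFDerivAt_tCoord (p : R6) : HasFDerivAt tCoord (tDeriv p • dCoord 1) p := by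
  refine ((hasFDerivAt_coord 1 p).arctan.const_mul (2 / Real.pi)).congr_fderiv ?_
  rw [smul_smul]
  congr 1
  unfold tDeriv
  field_simp

theorem exists_hasFDerivAt_tDeriv (p : R6) : ∃ k : ℝ, HasFDerivAt tDeriv (k • dCoord 1) p := by
  have h : DifferentiableAt ℝ (fun s : ℝ => 2 / (Real.pi * (1 + s ^ 2))) (p 1) :=
    DifferentiableAt.div (by fun_prop) (by fun_prop) (by positivity)
  exact ⟨_, h.hasDerivAt.comp_hasFDerivAt (f := fun y : R6 => y 1) p (hasFDerivAt_coord 1 p)⟩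

theorem betaOne_eq (p : R6) : betaOne p = dCoord 4 - p 2 • dCoord 0 - (p 3 * tDeriv p) • dCoord 1
    - (tCoord p ^ 3 / 3 + tCoord p + 2 * p 0) • dCoord 2 := by
  have hx₂ : 2 * p 3 / (Real.pi * (1 + p 1 ^ 2)) = p 3 * tDeriv p := by
    unfold tDeriv
    ring
  have hcube : 8 / (3 * Real.pi ^ 3) * Real.arctan (p 1) ^ 3 = tCoord p ^ 3 / 3 := by
    unfold tCoord
    field_simp
    ring
  rw [betaOne, hx₂, hcube]
  rfl

theorem betaTwo_eq (p : R6) : betaTwo p = dCoord 5 - p 3 • dCoord 0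
    - (p 2 * tDeriv p) • dCoord 1 := by
  have hx₂ : 2 * p 2 / (Real.pi * (1 + p 1 ^ 2)) = p 2 * tDeriv p := by
    unfold tDeriv
    ring
  rw [betaTwo, hx₂]

theorem contDiff_betaOne : ContDiff ℝ ∞ betaOne := by
  rw [show betaOne = _ from funext betaOne_eq]
  have := contDiff_tDeriv
  have := contDiff_tCoord
  have := contDiff_coord
  fun_prop

theorem contDiff_betaTwo : ContDiff ℝ ∞ betaTwo := by
  rw [show betaTwo = _ from funext betaTwo_eq]
  have := contDiff_tDeriv
  have := contDiff_coord
  fun_prop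

theorem extDerivBilin_betaOne (p u v : R6) :
    extDerivBilin ℝ betaOne p u v
      = -(u 0 * v 2 - u 2 * v 0) + tDeriv p * (u 1 * v 3 - u 3 * v 1)
        - (1 + tCoord p ^ 2) * tDeriv p * (u 1 * v 2 - u 2 * v 1) := by
  obtain ⟨k, hk⟩ := exists_hasFDerivAt_tDeriv p
  have ht := hasFDerivAt_tCoord p
  have hbeta : HasFDerivAt betaOne _ p := ((((hasFDerivAt_const (dCoord 4) p).sub
    ((hasFDerivAt_coord 2 p).smul_const (dCoord 0))).sub
    (((hasFDerivAt_coord 3 p).mul hk).smul_const (dCoord 1))).sub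
    ((((ht.pow 3).mul_const (1 / 3)).add ht |>.add
      ((hasFDerivAt_coord 0 p).const_mul 2)).smul_const (dCoord 2))).congr_of_eventuallyEq
        (Filter.Eventually.of_forall fun y => by rw [betaOne_eq]; simp [div_eq_mul_inv])
  rw [extDerivBilin_apply, hbeta.fderiv]
  simp only [zero_sub, sub_apply, neg_apply, add_apply, smul_apply,
    ContinuousLinearMap.smulRight_apply, dCoord_apply, smul_eq_mul, nsmul_eq_mul, Nat.cast_ofNat,
    Nat.add_one_sub_one]
  ring

theorem extDerivBilin_betaTwo (p u v : R6) :
    extDerivBilin ℝ betaTwo p u v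
      = (u 0 * v 3 - u 3 * v 0) + tDeriv p * (u 1 * v 2 - u 2 * v 1) := by
  obtain ⟨k, hk⟩ := exists_hasFDerivAt_tDeriv p
  have hbeta : HasFDerivAt betaTwo _ p := (((hasFDerivAt_const (dCoord 5) p).sub
    ((hasFDerivAt_coord 3 p).smul_const (dCoord 0))).sub
    (((hasFDerivAt_coord 2 p).mul hk).smul_const (dCoord 1))).congr_of_eventuallyEq
      (Filter.Eventually.of_forall fun y => by rw [betaTwo_eq]; simp)
  rw [extDerivBilin_apply, hbeta.fderiv]
  simp only [zero_sub, sub_apply, neg_apply, add_apply, smul_apply,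
    ContinuousLinearMap.smulRight_apply, dCoord_apply, smul_eq_mul]
  ring

/-- The coframe `(β₁, β₂)` defining `xi`. -/
def beta : Fin 2 → R6 → R6 →L[ℝ] ℝ := ![betaOne, betaTwo]

/-- The constant values of the Reeb directions `∂_{z₁}`, `∂_{z₂}`. -/
def reebVector : Fin 2 → R6 := ![EuclideanSpace.single 4 1, EuclideanSpace.single 5 1]

theorem contDiff_beta (i : Fin 2) : ContDiff ℝ ∞ (beta i) := by
  fin_cases i
  · exact contDiff_betaOne
  · exact contDiff_betaTwo

theorem differentiableAt_beta (i : Fin 2) (p : R6) : DifferentiableAt ℝ (beta i) p :=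
  (contDiff_beta i).differentiable (by simp) p

theorem isKernelOn_xi (U : Set R6) : IsKernelOn xi beta U := fun _ _ => rfl

theorem mem_xi_iff (p v : R6) : v ∈ xi p ↔ ∀ i, beta i p v = 0 :=
  (isKernelOn_xi Set.univ).mem_iff (Set.mem_univ p) v

theorem beta_reebVector (p : R6) (i j : Fin 2) :
    beta i p (reebVector j) = if i = j then 1 else 0 := by
  fin_cases i <;> fin_cases j <;> simp [beta, reebVector, betaOne_eq, betaTwo_eq, dCoord_apply]

theorem extDerivBilin_beta_reebVector (p v : R6) (i j : Fin 2) :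
    extDerivBilin ℝ (beta j) p (reebVector i) v = 0 := by
  fin_cases i <;> fin_cases j <;>
    simp [beta, reebVector, extDerivBilin_betaOne, extDerivBilin_betaTwo]

theorem isCorankTwoGerm_xi (q : R6) : IsCorankTwoGerm xi q :=
  ⟨Set.univ, isOpen_univ, trivial, beta, fun i => (contDiff_beta i).contDiffOn,
    fun x _ => LinearIndependent.of_pairwise_dual_eq_zero_one (fun i => beta i x)
      (fun j => (ContinuousLinearMap.apply ℝ ℝ (reebVector j)).toLinearMap)
      (fun i j hij => by simp [beta_reebVector, Ne.symm hij]) (fun i => by simp [beta_reebVector]),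
    isKernelOn_xi _⟩

theorem hasReebDirections_xi (q : R6) : HasReebDirections xi ![coordField 4, coordField 5] q := by
  have hfield : (![coordField 4, coordField 5] : Fin 2 → R6 → R6) = fun i _ => reebVector i :=
    funext (Fin.forall_fin_two.2 ⟨rfl, rfl⟩)
  rw [hfield]
  refine ⟨Set.univ, isOpen_univ, trivial, fun i => contDiffOn_const, beta,
    fun i => (contDiff_beta i).contDiffOn, isKernelOn_xi _, fun x _ => ⟨?_, beta_reebVector x,
      fun i j v _ => ?_, ?_⟩⟩
  · exact isCompl_span_range_of_dual (φ := fun i => (beta i x : R6 →ₗ[ℝ] ℝ)) (beta_reebVector x)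
      (mem_xi_iff x)
  · rw [extDerivOne, extDeriv_ofSubsingleton, extDerivBilin_beta_reebVector]
  · simp [VectorField.lieBracket]

/-- The frame `X₁, X₂, Y₁, Y₂` of `xi` lifting the first four coordinate vector fields. -/
def horizontalFrame (p : R6) : Fin 4 → R6 :=
  ![!₂[1, 0, 0, 0, p 2, p 3], !₂[0, 1, 0, 0, p 3 * tDeriv p, p 2 * tDeriv p],
    !₂[0, 0, 1, 0, tCoord p ^ 3 / 3 + tCoord p + 2 * p 0, 0], !₂[0, 0, 0, 1, 0, 0]]

theorem horizontalFrame_mem_xi (p : R6) (i : Fin 4) : horizontalFrame p i ∈ xi p := by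
  rw [mem_xi_iff, Fin.forall_fin_two]
  fin_cases i <;> simp [beta, betaOne_eq, betaTwo_eq, dCoord_apply, horizontalFrame]

theorem eq_zero_of_mem_xi {v : R6} (hv : v ∈ xi p) (h : ∀ i : Fin 4, v (i.castLE (by decide)) = 0) :
    v = 0 := by
  have h0 : v 0 = 0 := h 0
  have h1 : v 1 = 0 := h 1
  have h2 : v 2 = 0 := h 2
  have h3 : v 3 = 0 := h 3
  rw [mem_xi_iff, Fin.forall_fin_two] at hv
  have h45 : v 4 = 0 ∧ v 5 = 0 := by
    simpa [beta, betaOne_eq, betaTwo_eq, dCoord_apply, h0, h1, h2] using hv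
  ext i
  fin_cases i
  exacts [h0, h1, h2, h3, h45.1, h45.2]

theorem dualBases_horizontalFrame (p : R6) : Module.DualBases
    (fun i => (⟨horizontalFrame p i, horizontalFrame_mem_xi p i⟩ : xi p))
    (fun i => (dCoord (i.castLE (by decide))).toLinearMap.comp (xi p).subtype) where
  eval_same i := by fin_cases i <;> simp [horizontalFrame, dCoord_apply]
  eval_of_ne i j hij := by
    fin_cases i <;> fin_cases j <;> first | exact absurd rfl hij |
      simp [horizontalFrame, dCoord_apply]
  total {v w} h := Subtype.ext <| sub_eq_zero.1 <|
    eq_zero_of_mem_xi (sub_mem v.2 w.2) fun i => sub_eq_zero.2 (h i)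
  finite _ := Set.toFinite _

/-- `horizontalFrame` as a basis of the fibres of `xi`. -/
def horizontalBasis (p : R6) : Module.Basis (Fin 4) ℝ (xi p) := (dualBases_horizontalFrame p).basis

theorem coe_horizontalBasis (p : R6) (i : Fin 4) :
    (horizontalBasis p i : R6) = horizontalFrame p i := by
  simp [horizontalBasis]

end Distribution

section Fatness

variable {p : R6}

/-- The quadric `a² + b² - (1 + t²)ab`, in terms of which the fatness quadratic form of `xi` at the
covector with values `(a, b)` on the Reeb directions is expressed. The values may be complex, for
complex-valued one-forms that vanish on `xi`. -/
def fatnessQuadric {R : Type*} [CommRing R] [Algebra ℝ R] (t : ℝ) (a : Fin 2 → R) : R :=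
  a 0 ^ 2 + a 1 ^ 2 - (1 + t ^ 2) • (a 0 * a 1)

theorem fatnessQuadric_pos {t : ℝ} (ht : t ^ 2 < 1) {a : Fin 2 → ℝ} (ha : a ≠ 0) :
    0 < fatnessQuadric t a := by
  have hsum : 0 < a 0 ^ 2 + a 1 ^ 2 := by
    obtain ⟨i, hi⟩ := Function.ne_iff.1 ha
    fin_cases i <;> simp only [Pi.zero_apply] at hi <;> positivity
  calc 0 < (1 - t ^ 2) / 2 * (a 0 ^ 2 + a 1 ^ 2) := mul_pos (by linarith) hsum
    _ ≤ (1 - t ^ 2) / 2 * (a 0 ^ 2 + a 1 ^ 2) + (1 + t ^ 2) / 2 * (a 0 - a 1) ^ 2 :=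
      le_add_of_nonneg_right (by positivity)
    _ = fatnessQuadric t a := by
      rw [fatnessQuadric, smul_eq_mul]
      ring

theorem pfaffian_horizontalFrame {R : Type*} [CommRing R] [Algebra ℝ R] (p : R6) (a : Fin 2 → R) :
    pfaffian (Matrix.of fun i j => ∑ k,
      extDerivBilin ℝ (beta k) p (horizontalFrame p i) (horizontalFrame p j) • a k)
        = tDeriv p • fatnessQuadric (tCoord p) a := by
  simp only [pfaffian, fatnessQuadric, Matrix.of_apply, Fin.sum_univ_two, beta, Matrix.cons_val,
    extDerivBilin_betaOne, extDerivBilin_betaTwo, horizontalFrame, Algebra.smul_def, map_add,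
    map_sub, map_mul, map_neg, map_pow, map_one, map_zero]
  ring

theorem eq_zero_of_apply_reebVector_eq_zero {ψ : Module.Dual ℝ (R6 ⧸ xi p)}
    (h : ∀ k, ψ ((xi p).mkQ (reebVector k)) = 0) : ψ = 0 := by
  refine Submodule.linearMap_qext _ (LinearMap.ext fun v => ?_)
  have hψ := apply_eq_sum_of_eq_zero_on_ker (φ := fun i => (beta i p : R6 →ₗ[ℝ] ℝ))
    (f := ψ ∘ₗ (xi p).mkQ) (beta_reebVector p) (mem_xi_iff p)
    (fun v hv => by simp [(Submodule.Quotient.mk_eq_zero _).2 hv]) v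
  simpa only [LinearMap.comp_apply, LinearMap.zero_apply, h, smul_zero,
    Finset.sum_const_zero] using hψ

theorem curvatureForm_horizontalBasis (p : R6) (ψ : Module.Dual ℝ (R6 ⧸ xi p)) :
    curvatureForm (coframeCurvature beta reebVector p (xi p)) (horizontalBasis p) ψ ψ
      = 2 * (tDeriv p
        * fatnessQuadric (tCoord p) fun k => -ψ ((xi p).mkQ (reebVector k))) := by
  rw [curvatureForm_self, ← smul_eq_mul (tDeriv p), ← pfaffian_horizontalFrame]
  congr 3
  ext i j
  simp [coframeCurvature_apply, coe_horizontalBasis]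

theorem isEllipticAt_xi (p : R6) : IsEllipticAt xi p := by
  refine isEllipticAt_of_curvatureForm_pos (isCurvatureAt_coframeCurvature Filter.univ_mem
    (isKernelOn_xi _) (fun i => differentiableAt_beta i p) (beta_reebVector p)) (fun v => ?_)
    (horizontalBasis p) fun ψ hψ => ?_
  · simp [coframeCurvature_apply, extDerivBilin_self]
  · have hψreeb : (fun k => -ψ ((xi p).mkQ (reebVector k))) ≠ 0 := fun h =>
      hψ (eq_zero_of_apply_reebVector_eq_zero fun k => neg_eq_zero.1 (congrFun h k))
    rw [curvatureForm_horizontalBasis]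
    have := fatnessQuadric_pos (tCoord_sq_lt_one p) hψreeb
    have := tDeriv_pos p
    positivity

theorem isFatGerm_xi (q : R6) : IsFatGerm xi q :=
  ⟨isCorankTwoGerm_xi q, Filter.Eventually.of_forall isEllipticAt_xi⟩

end Fatness

section Obstruction

theorem fderiv_fatnessQuadric {E : Type*} [NormedAddCommGroup E] [NormedSpace ℝ E] {t : E → ℝ}
    {a : Fin 2 → E → ℂ} {x : E} (ht : DifferentiableAt ℝ t x)
    (ha : ∀ i, DifferentiableAt ℝ (a i) x) (u : E) :
    fderiv ℝ (fun y => fatnessQuadric (t y) fun i => a i y) x u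
      = (2 * a 0 x - (1 + t x ^ 2) * a 1 x) * fderiv ℝ (a 0) x u
        + (2 * a 1 x - (1 + t x ^ 2) * a 0 x) * fderiv ℝ (a 1) x u
        - 2 * t x * fderiv ℝ t x u * (a 0 x * a 1 x) := by
  have h : HasFDerivAt (fun y => fatnessQuadric (t y) fun i => a i y) _ x :=
    (((ha 0).hasFDerivAt.pow 2).add ((ha 1).hasFDerivAt.pow 2)).sub
      (((ht.hasFDerivAt.pow 2).const_add 1).smul ((ha 0).hasFDerivAt.mul (ha 1).hasFDerivAt))
  rw [h.fderiv]
  simp only [sub_apply, add_apply, smul_apply, ContinuousLinearMap.smulRight_apply, smul_eq_mul,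
    nsmul_eq_mul, Nat.cast_ofNat, Nat.add_one_sub_one, pow_one, Complex.real_smul,
    Complex.ofReal_add, Complex.ofReal_mul, Complex.ofReal_pow, Complex.ofReal_one,
    Complex.ofReal_ofNat]
  ring

variable {U : Set R6} {α : R6 → R6 →L[ℝ] ℂ} {x : R6}

theorem apply_reebVector_ne_zero (hker : ∀ v, v ∈ xi x ↔ α x v = 0) (i : Fin 2) :
    α x (reebVector i) ≠ 0 := fun h => by
  simpa [beta_reebVector] using (mem_xi_iff x _).1 ((hker _).2 h) i

theorem extDerivBilin_apply_of_ker_eq_xi (hU : U ∈ 𝓝 x) (hα : DifferentiableAt ℝ α x)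
    (hker : ∀ y ∈ U, ∀ v, v ∈ xi y ↔ α y v = 0) (u v : R6) :
    extDerivBilin ℝ α x u v = ∑ i, (extDerivBilin ℝ (beta i) x u v • α x (reebVector i)
      + beta i x v • fderiv ℝ (fun y => α y (reebVector i)) x u
      - beta i x u • fderiv ℝ (fun y => α y (reebVector i)) x v) := by
  have hsum : α =ᶠ[𝓝 x] fun y => ∑ i, (beta i y).smulRight (α y (reebVector i)) := by
    filter_upwards [hU] with y hy
    ext v
    simpa using apply_eq_sum_of_eq_zero_on_ker (φ := fun i => (beta i y : R6 →ₗ[ℝ] ℝ))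
      (f := (α y : R6 →ₗ[ℝ] ℂ)) (beta_reebVector y) (mem_xi_iff y)
      (fun v hv => (hker y hy v).1 hv) v
  rw [extDerivBilin_congr hsum, extDerivBilin_sum_smulRight (fun i => differentiableAt_beta i x)
    fun i => hα.clm_apply (differentiableAt_const _)]

theorem extDerivBilin_apply_horizontal (hU : U ∈ 𝓝 x) (hα : DifferentiableAt ℝ α x)
    (hker : ∀ y ∈ U, ∀ v, v ∈ xi y ↔ α y v = 0) {u v : R6} (hu : u ∈ xi x) (hv : v ∈ xi x) :
    extDerivBilin ℝ α x u v
      = ∑ i, extDerivBilin ℝ (beta i) x u v • α x (reebVector i) := by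
  simp [extDerivBilin_apply_of_ker_eq_xi hU hα hker, (mem_xi_iff x _).1 hu, (mem_xi_iff x _).1 hv]

theorem extDerivBilin_apply_reebVector (hU : U ∈ 𝓝 x) (hα : DifferentiableAt ℝ α x)
    (hker : ∀ y ∈ U, ∀ v, v ∈ xi y ↔ α y v = 0) {u : R6} (hu : u ∈ xi x) (j : Fin 2) :
    extDerivBilin ℝ α x u (reebVector j) = fderiv ℝ (fun y => α y (reebVector j)) x u := by
  have hflip (i : Fin 2) : extDerivBilin ℝ (beta i) x u (reebVector j) = 0 := by
    rw [extDerivBilin_apply, ← neg_sub, ← extDerivBilin_apply, extDerivBilin_beta_reebVector,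
      neg_zero]
  simp [extDerivBilin_apply_of_ker_eq_xi hU hα hker, hflip, (mem_xi_iff x _).1 hu, beta_reebVector]

theorem fatnessQuadric_eq_zero (hU : U ∈ 𝓝 x) (hα : DifferentiableAt ℝ α x)
    (hker : ∀ y ∈ U, ∀ v, v ∈ xi y ↔ α y v = 0)
    (hpf : ∀ w : Fin 4 → R6, pfaffian (Matrix.of fun i j => extDerivBilin ℝ α x (w i) (w j)) = 0) :
    fatnessQuadric (tCoord x) (fun i => α x (reebVector i)) = 0 := by
  have h := hpf (horizontalFrame x)
  simp only [
    extDerivBilin_apply_horizontal hU hα hker (horizontalFrame_mem_xi x _)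
      (horizontalFrame_mem_xi x _),
    pfaffian_horizontalFrame] at h
  exact (smul_eq_zero.1 h).resolve_left (tDeriv_pos x).ne'

/-- With `a`, `b` the values of `α` on the Reeb directions, this is the vanishing of the derivatives
of `a` and `b` along the complex vector field `a X₂ + (∂t / ∂x₂)(b - (1 + t²)a) X₁`. -/
theorem fderiv_apply_reebVector_relation (hU : U ∈ 𝓝 x) (hα : DifferentiableAt ℝ α x)
    (hker : ∀ y ∈ U, ∀ v, v ∈ xi y ↔ α y v = 0)
    (hpf : ∀ w : Fin 4 → R6, pfaffian (Matrix.of fun i j => extDerivBilin ℝ α x (w i) (w j)) = 0)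
    (j : Fin 2) :
    α x (reebVector 0) * fderiv ℝ (fun y => α y (reebVector j)) x (horizontalFrame x 1)
      + tDeriv x * (α x (reebVector 1) - (1 + tCoord x ^ 2) * α x (reebVector 0))
        * fderiv ℝ (fun y => α y (reebVector j)) x (horizontalFrame x 0) = 0 := by
  let X := horizontalFrame x
  have hX : ∀ i, X i ∈ xi x := horizontalFrame_mem_xi x
  have h₀₁ : extDerivBilin ℝ α x (X 0) (X 1) = 0 := by
    rw [extDerivBilin_apply_horizontal hU hα hker (hX 0) (hX 1)]
    simp [X, horizontalFrame, beta, extDerivBilin_betaOne, extDerivBilin_betaTwo]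
  have h₀₂ : extDerivBilin ℝ α x (X 0) (X 2) = -α x (reebVector 0) := by
    rw [extDerivBilin_apply_horizontal hU hα hker (hX 0) (hX 2)]
    simp [X, horizontalFrame, beta, extDerivBilin_betaOne, extDerivBilin_betaTwo]
  have h₁₂ : extDerivBilin ℝ α x (X 1) (X 2)
      = tDeriv x * (α x (reebVector 1) - (1 + tCoord x ^ 2) * α x (reebVector 0)) := by
    rw [extDerivBilin_apply_horizontal hU hα hker (hX 1) (hX 2)]
    simp only [X, horizontalFrame, beta, Fin.sum_univ_two, Matrix.cons_val, extDerivBilin_betaOne,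
      extDerivBilin_betaTwo, Complex.real_smul]
    push_cast
    ring
  have h := hpf ![X 0, X 1, X 2, reebVector j]
  simp only [pfaffian, Matrix.of_apply, Matrix.cons_val] at h
  rw [h₀₁, h₀₂, h₁₂, extDerivBilin_apply_reebVector hU hα hker (hX 0),
    extDerivBilin_apply_reebVector hU hα hker (hX 1)] at h
  linear_combination h

theorem tCoord_eq_zero_of_pfaffian_eq_zero (hU : IsOpen U) (hα : DifferentiableOn ℝ α U)
    (hker : ∀ y ∈ U, ∀ v, v ∈ xi y ↔ α y v = 0)
    (hpf : ∀ y ∈ U, ∀ w : Fin 4 → R6,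
      pfaffian (Matrix.of fun i j => extDerivBilin ℝ α y (w i) (w j)) = 0)
    (hxU : x ∈ U) : tCoord x = 0 := by
  have hαU {y : R6} (hy : y ∈ U) : DifferentiableAt ℝ α y := hα.differentiableAt (hU.mem_nhds hy)
  let a (i : Fin 2) (y : R6) : ℂ := α y (reebVector i)
  have hquadric : (fun y => fatnessQuadric (tCoord y) fun i => a i y) =ᶠ[𝓝 x] fun _ => 0 := by
    filter_upwards [hU.mem_nhds hxU] with y hy
    exact fatnessQuadric_eq_zero (hU.mem_nhds hy) (hαU hy) hker (hpf y hy)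
  have hderiv (u : R6) : (2 * a 0 x - (1 + tCoord x ^ 2) * a 1 x) * fderiv ℝ (a 0) x u
      + (2 * a 1 x - (1 + tCoord x ^ 2) * a 0 x) * fderiv ℝ (a 1) x u
      - 2 * tCoord x * (tDeriv x * u 1 : ℝ) * (a 0 x * a 1 x) = 0 := by
    have h := fderiv_fatnessQuadric (a := a) (hasFDerivAt_tCoord x).differentiableAt
      (fun i => (hαU hxU).clm_apply (differentiableAt_const (reebVector i))) u
    rw [hquadric.fderiv_eq, (hasFDerivAt_tCoord x).fderiv] at h
    simpa [dCoord_apply] using h.symm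
  have hX₀ := hderiv (horizontalFrame x 0)
  have hX₁ := hderiv (horizontalFrame x 1)
  rw [show horizontalFrame x 0 1 = 0 from rfl] at hX₀
  rw [show horizontalFrame x 1 1 = 1 from rfl] at hX₁
  have hrel := fderiv_apply_reebVector_relation (hU.mem_nhds hxU) (hαU hxU) hker (hpf x hxU)
  have hprod : tCoord x * tDeriv x * a 0 x ^ 2 * a 1 x = 0 := by
    push_cast at hX₀ hX₁
    linear_combination (a 0 x - (1 + tCoord x ^ 2) / 2 * a 1 x) * hrel 0
      + (a 1 x - (1 + tCoord x ^ 2) / 2 * a 0 x) * hrel 1 - a 0 x / 2 * hX₁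
      - tDeriv x * (a 1 x - (1 + tCoord x ^ 2) * a 0 x) / 2 * hX₀
  have ha (i : Fin 2) : a i x ≠ 0 := apply_reebVector_ne_zero (hker x hxU) i
  simpa [(tDeriv_pos x).ne', ha] using hprod

theorem dense_setOf_apply_one_ne_zero : Dense {x : R6 | x 1 ≠ 0} :=
  (dense_compl_singleton (0 : ℝ)).preimage <|
    (dCoord 1).isOpenMap fun s => ⟨EuclideanSpace.single 1 s, by simp [dCoord_apply]⟩

theorem exists_pfaffian_extDerivBilin_ne_zero (hU : IsOpen U) (hne : U.Nonempty)
    (hα : DifferentiableOn ℝ α U) (hker : ∀ y ∈ U, ∀ v, v ∈ xi y ↔ α y v = 0) :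
    ∃ x ∈ U, ∃ w : Fin 4 → R6,
      pfaffian (Matrix.of fun i j => extDerivBilin ℝ α x (w i) (w j)) ≠ 0 := by
  by_contra! hpf
  obtain ⟨x, hxU, hx⟩ := dense_setOf_apply_one_ne_zero.inter_open_nonempty U hU hne
  exact tCoord_ne_zero hx (tCoord_eq_zero_of_pfaffian_eq_zero hU hα hker hpf hxU)

end Obstruction

section HolomorphicKernel

theorem pfaffian_extDerivBilin_pullback_eq_zero {E G : Type*} [NormedAddCommGroup E]
    [NormedSpace ℝ E] [NormedAddCommGroup G] [NormedSpace ℂ G] [FiniteDimensional ℂ G]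
    (hG : Module.finrank ℂ G < 4) {θ : G → G →L[ℂ] ℂ} {F : E → G} {x : E}
    (hθ : DifferentiableAt ℂ θ (F x)) (hF : ContDiffAt ℝ 2 F x) (w : Fin 4 → E) :
    pfaffian (Matrix.of fun i j => extDerivBilin ℝ
      (fun y => ((θ (F y)).restrictScalars ℝ).comp (fderiv ℝ F y)) x (w i) (w j)) = 0 := by
  have hpullback (u v : E) :
      extDerivBilin ℝ (fun y => ((θ (F y)).restrictScalars ℝ).comp (fderiv ℝ F y)) x u v
        = extDerivBilin ℂ θ (F x) (fderiv ℝ F x u) (fderiv ℝ F x v) := by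
    rw [extDerivBilin_pullback (θ := fun y => (θ y).restrictScalars ℝ)
      (hasFDerivAt_restrictScalars_oneForm ℝ hθ).differentiableAt hF (by simp),
      extDerivBilin_restrictScalars ℝ hθ]
  simp only [hpullback]
  exact pfaffian_eq_zero_of_finrank_lt_four hG
    (B := (extDerivBilin ℂ θ (F x)).toLinearMap₁₂) (fun u => extDerivBilin_self θ (F x) u) _

theorem not_ker_pullback_eq_xi {U : Set R6} (hU : IsOpen U) (hne : U.Nonempty) {F : R6 → C3}
    (hF : ContDiffOn ℝ 2 F U) {θ : C3 → C3 →L[ℂ] ℂ} (hθ : ∀ x ∈ U, DifferentiableAt ℂ θ (F x)) :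
    ¬ ∀ x ∈ U, ∀ v, v ∈ xi x ↔ θ (F x) (fderiv ℝ F x v) = 0 := by
  intro hker
  have hFU {x : R6} (hx : x ∈ U) : ContDiffAt ℝ 2 F x := hF.contDiffAt (hU.mem_nhds hx)
  have hα : DifferentiableOn ℝ (fun y => ((θ (F y)).restrictScalars ℝ).comp (fderiv ℝ F y)) U :=
    fun x hx =>
      (((hasFDerivAt_restrictScalars_oneForm ℝ (hθ x hx)).differentiableAt.comp x
        ((hFU hx).differentiableAt two_ne_zero)).clm_comp
        (((hFU hx).fderiv_right one_add_one_eq_two.le).differentiableAt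
          one_ne_zero)).differentiableWithinAt
  obtain ⟨x, hxU, w, hw⟩ := exists_pfaffian_extDerivBilin_ne_zero hU hne hα hker
  exact hw (pfaffian_extDerivBilin_pullback_eq_zero (by simp) (hθ x hxU) (hFU hxU) w)

/-- Near `p`, the distribution `D` is the kernel of the pullback of a holomorphic one-form `θ` on an
open subset of `C3` under a smooth map `F`. Underlying real distributions of complex contact
structures are of this kind, with `F` a holomorphic chart. -/
def IsHolomorphicKernelGerm {M : Type*} [TopologicalSpace M] [ChartedSpace R6 M]
    (D : ∀ x : M, Submodule ℝ (TangentSpace 𝓘(ℝ, R6) x)) (p : M) : Prop :=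
  ∃ U : Set M, IsOpen U ∧ p ∈ U ∧ ∃ (F : M → C3) (θ : C3 → C3 →L[ℂ] ℂ),
    ContMDiffOn 𝓘(ℝ, R6) 𝓘(ℝ, C3) ∞ F U ∧ (∀ x ∈ U, DifferentiableAt ℂ θ (F x)) ∧
    ∀ x ∈ U, ∀ v : TangentSpace 𝓘(ℝ, R6) x,
      v ∈ D x ↔ θ (F x) (mfderiv 𝓘(ℝ, R6) 𝓘(ℝ, C3) F x v) = 0

variable {M M' : Type*} [TopologicalSpace M] [ChartedSpace R6 M] [TopologicalSpace M']
  [ChartedSpace R6 M'] {D : ∀ x : M, Submodule ℝ (TangentSpace 𝓘(ℝ, R6) x)} {p : M}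
  {D' : ∀ x : M', Submodule ℝ (TangentSpace 𝓘(ℝ, R6) x)} {p' : M'}

theorem not_isHolomorphicKernelGerm_xi (q : R6) : ¬ IsHolomorphicKernelGerm (M := R6) xi q := by
  rintro ⟨U, hU, hqU, F, θ, hF, hθ, hker⟩
  refine not_ker_pullback_eq_xi hU ⟨q, hqU⟩
    (contDiffOn_infty.1 (contMDiffOn_iff_contDiffOn.1 hF) 2) hθ fun x hx v => ?_
  rw [← mfderiv_eq_fderiv]
  exact hker x hx v

theorem GermDiffeomorphic.isHolomorphicKernelGerm (h : GermDiffeomorphic D p D' p')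
    (hD' : IsHolomorphicKernelGerm D' p') : IsHolomorphicKernelGerm D p := by
  obtain ⟨g, hpg, rfl, hg, -, hgD⟩ := h
  obtain ⟨U, hU, hpU, F, θ, hF, hθ, hker⟩ := hD'
  refine ⟨g.source ∩ g ⁻¹' U, g.isOpen_inter_preimage hU, ⟨hpg, hpU⟩, F ∘ g, θ,
    hF.comp (hg.mono Set.inter_subset_left) fun x hx => hx.2, fun x hx => hθ (g x) hx.2,
    fun x hx v => (hgD x hx.1 v).trans ((hker (g x) hx.2 _).trans ?_)⟩
  rw [mfderiv_comp x ((hF.contMDiffAt (hU.mem_nhds hx.2)).mdifferentiableAt (by simp))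
    ((hg.contMDiffAt (g.open_source.mem_nhds hx.1)).mdifferentiableAt (by simp))]
  rfl

theorem SupportsComplexContact.isHolomorphicKernelGerm (h : SupportsComplexContact D p) :
    IsHolomorphicKernelGerm D p := by
  obtain ⟨N, _, _, _, H, f, hH, hpf, hf, -, hfD⟩ := h
  have := isManifold_restrictScalars (N := N) (E := C3) (n := ω) ℝ ℂ
  obtain ⟨V, hV, hpV, -, θ, hθ, -, hθH⟩ := hH (f p)
  let φ := chartAt C3 (f p)
  have hφV : IsOpen (φ.source ∩ φ ⁻¹' V) := φ.isOpen_inter_preimage hV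
  have hφ : ContMDiffOn 𝓘(ℝ, C3) 𝓘(ℝ, C3) ∞ φ φ.source := contMDiffOn_chart
  refine ⟨f.source ∩ f ⁻¹' (φ.source ∩ φ ⁻¹' V), f.isOpen_inter_preimage hφV,
    ⟨hpf, mem_chart_source C3 (f p), hpV⟩, φ ∘ f, θ,
    hφ.comp (hf.mono Set.inter_subset_left) fun x hx => hx.2.1,
    fun x hx => hθ.differentiableAt (hV.mem_nhds hx.2.2), fun x ⟨hxf, hxφ, hxV⟩ v => ?_⟩
  have hφx : HasMFDerivAt 𝓘(ℝ, C3) 𝓘(ℝ, C3) φ (f x) _ := hasMFDerivAt_restrictScalars ℝ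
    (mdifferentiableAt_atlas (I := 𝓘(ℂ, C3)) (chart_mem_atlas C3 (f p)) hxφ).hasMFDerivAt
  have hfx := ((hf.contMDiffAt (f.open_source.mem_nhds hxf)).mdifferentiableAt
    (by simp)).hasMFDerivAt
  rw [(hφx.comp x hfx).mfderiv]
  exact (hfD x hxf v).trans (hθH (f x) hxφ hxV _)

theorem GermDiffeomorphic.refl (D : ∀ x : M, Submodule ℝ (TangentSpace 𝓘(ℝ, R6) x)) (p : M) :
    GermDiffeomorphic D p D p := by
  refine ⟨OpenPartialHomeomorph.refl M, trivial, rfl, contMDiffOn_id, contMDiffOn_id,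
    fun x _ v => ?_⟩
  have hid : mfderiv 𝓘(ℝ, R6) 𝓘(ℝ, R6) (OpenPartialHomeomorph.refl M) x
      = .id ℝ (TangentSpace 𝓘(ℝ, R6) x) := mfderiv_id
  rw [hid]
  rfl

theorem not_supportsComplexContact_of_germDiffeomorphic_xi {q : R6}
    (h : GermDiffeomorphic (M := R6) xi q D p) : ¬ SupportsComplexContact D p := fun hD =>
  not_isHolomorphicKernelGerm_xi q (h.isHolomorphicKernelGerm hD.isHolomorphicKernelGerm)

end HolomorphicKernel

end

theorem mainTheorem1 :
    (∀ q : R6,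
      IsFatGerm xi q ∧
      HasReebDirections xi ![coordField 4, coordField 5] q ∧
      ∀ (M : Type*) [TopologicalSpace M] [ChartedSpace R6 M] [IsManifold 𝓘(ℝ, R6) ∞ M]
        (D : ∀ x : M, Submodule ℝ (TangentSpace 𝓘(ℝ, R6) x)) (p : M),
        GermDiffeomorphic xi q D p → ¬ SupportsComplexContact D p) ∧
    ¬ ∀ (D : R6 → Submodule ℝ R6) (q : R6),
        IsFatGerm D q → (∃ Z : Fin 2 → R6 → R6, HasReebDirections D Z q) →
          SupportsComplexContact (M := R6) D q := by
  refine ⟨fun q => ⟨isFatGerm_xi q, hasReebDirections_xi q, ?_⟩, fun h => ?_⟩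
  · intro M _ _ _ D p
    exact not_supportsComplexContact_of_germDiffeomorphic_xi
  · exact not_supportsComplexContact_of_germDiffeomorphic_xi (GermDiffeomorphic.refl (M := R6) xi 0)
      (h xi 0 (isFatGerm_xi 0) ⟨_, hasReebDirections_xi 0⟩)
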